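/- Let $R$ be a commutative Noetherian ring, let $n\ge 0$ be an integer, and let $S=R[t_1^{\pm1},\dots,t_n^{\pm1}]$ be the Laurent polynomial ring in indeterminates $t_1,\dots,t_n$. Let $A=(a_{ij})$ be an $n\times n$ integer matrix, acting on the column vectors $\mathbb{Z}^n$ by left multiplication, such that $\det A\neq 0$ and $\bigcap_{k=1}^{\infty}\operatorname{im}A^k=0$. Let $\phi\colon S\to S$ be an injective ring homomorphism such that $\phi(R)=R$ and such that, for every $j=1,\dots,n$, $$\phi(t_j)=g_j\prod_{i=1}^{n}t_i^{a_{ij}},$$ where $g_1,\dots,g_n$ are units of $R$. Let $\mathfrak{M}$ be a finitely generated $S$-module, and suppose that there is an isomorphism of additive groups $\eta\colon\mathfrak{M}\to\mathfrak{M}$ with $\eta(sx)=\phi(s)\eta(x)$ for all $s\in S$ and $x\in\mathfrak{M}$. Then $\mathfrak{M}$ is finitely generated as an $R$-module. -/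

import Mathlib

/-- The Laurent polynomial ring `R[t₁^{±1}, …, tₙ^{±1}]`, i.e. the group algebra of `ℤⁿ` over `R`. -/
abbrev MvLaurent (n : ℕ) (R : Type*) [CommRing R] : Type _ :=
  AddMonoidAlgebra R (Fin n → ℤ)

namespace MvLaurent

/-- The indeterminate `tᵢ`, as a unit of `R[t₁^{±1}, …, tₙ^{±1}]`. -/
noncomputable def T {n : ℕ} (R : Type*) [CommRing R] (i : Fin n) : (MvLaurent n R)ˣ where
  val := AddMonoidAlgebra.single (Pi.single i 1) 1
  inv := AddMonoidAlgebra.single (-Pi.single i 1) 1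
  val_inv := by
    simp [AddMonoidAlgebra.single_mul_single, AddMonoidAlgebra.one_def]
  inv_val := by
    simp [AddMonoidAlgebra.single_mul_single, AddMonoidAlgebra.one_def]

end MvLaurent

/-! It suffices that every monomial is integral over `R` modulo the annihilator of `M`, and this can
be tested in the residue fields of the finitely many minimal primes of the annihilator. Pulling back
along `φ` permutes these primes, so a power of `φ` stabilises a given one, `P`, and induces an
endomorphism `ψ` of its residue field `L`. A dimension count in `L ⊗ M` shows that `ψ` is onto
(`Ideal.ResidueField.map_surjective_of_semilinear`).

If some monomial were not integral in `L`, a homomorphism `h` from `Lˣ` to `ℤ`, trivial on the units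
of `R`, would be nonzero on it (`exists_hom_ne_one_of_not_isIntegral`). On exponents `h` is an
integer row `v`. Composing with `ψ⁻ᵏ` gives integer rows `w` with `v = w Aᵏ` for all `k`, so `v = 0`
by `Matrix.eq_zero_of_forall_exists_vecMul_pow`, a contradiction. Integer values are essential: over
`ℚ` every row is divisible by `Aᵏ`. -/

open WithZero
open scoped Matrix TensorProduct

/-! ### Integer matrices -/

/-- If the images of the powers of an integral matrix intersect trivially, then so do the images of
the powers of its transpose. -/
theorem Matrix.eq_zero_of_forall_exists_vecMul_pow {n : ℕ} {A : Matrix (Fin n) (Fin n) ℤ}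
    (hdet : A.det ≠ 0) (hA : ⨅ k : ℕ, LinearMap.range (A ^ (k + 1)).mulVecLin = ⊥)
    {v : Fin n → ℤ} (hv : ∀ k : ℕ, ∃ w : Fin n → ℤ, v = w ᵥ* A ^ k) : v = 0 := by
  by_contra hv0
  let N : Submodule ℤ (Fin n → ℤ) := ⨅ k : ℕ, LinearMap.range (A ^ k).vecMulLinear
  have memN (x : Fin n → ℤ) : x ∈ N ↔ ∀ k : ℕ, ∃ w : Fin n → ℤ, x = w ᵥ* A ^ k := by
    simp [N, Submodule.mem_iInf, eq_comm]
  have inj {x y : Fin n → ℤ} (h : x ᵥ* A = y ᵥ* A) : x = y := by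
    by_contra hne
    exact hdet (Matrix.exists_vecMul_eq_zero_iff.1
      ⟨x - y, sub_ne_zero.2 hne, by rw [Matrix.sub_vecMul, h, sub_self]⟩)
  have maps : ∀ x ∈ N, A.vecMulLinear x ∈ N := by
    intro x hx
    rw [memN] at hx ⊢
    intro k
    obtain ⟨w, rfl⟩ := hx k
    exact ⟨w ᵥ* A, by simp [Matrix.vecMul_vecMul, ← pow_succ, ← pow_succ']⟩
  let β : N →ₗ[ℤ] N := A.vecMulLinear.restrict maps
  have hβ (x : N) : (β x : Fin n → ℤ) = (x : Fin n → ℤ) ᵥ* A := rfl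
  have bij : Function.Bijective β := by
    constructor
    · intro x y h
      exact Subtype.ext (inj (by rw [← hβ, ← hβ, h]))
    · rintro ⟨x, hx⟩
      rw [memN] at hx
      obtain ⟨y, hy⟩ := hx 1
      rw [pow_one] at hy
      refine ⟨⟨y, (memN y).2 fun k => ?_⟩, Subtype.ext hy.symm⟩
      obtain ⟨w, hw⟩ := hx (k + 1)
      refine ⟨w, inj ?_⟩
      rw [← hy, hw, Matrix.vecMul_vecMul, pow_succ]
  -- Up to sign this coefficient is `det β`, and `β` is bijective over `ℤ`.
  have hunit : IsUnit (β.charpoly.coeff 0) := by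
    have h : IsUnit β.det := by
      have := (LinearEquiv.ofBijective β bij).isUnit_det'
      exact this
    rw [LinearMap.det_eq_sign_charpoly_coeff] at h
    exact isUnit_of_mul_isUnit_right h
  set q := β.charpoly with hq
  have hpow (k : ℕ) (x : N) : (((β ^ k) x : N) : Fin n → ℤ) = (x : Fin n → ℤ) ᵥ* A ^ k := by
    induction k generalizing x with
    | zero => simp
    | succ k ih => rw [pow_succ, Module.End.mul_apply, ih, hβ, Matrix.vecMul_vecMul, pow_succ']
  have haeval (p : Polynomial ℤ) (x : N) :
      ((Polynomial.aeval β p x : N) : Fin n → ℤ) = (x : Fin n → ℤ) ᵥ* Polynomial.aeval A p := by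
    induction p using Polynomial.induction_on' with
    | add p r hp hr => simp [hp, hr, Matrix.vecMul_add]
    | monomial k a =>
      simp only [Polynomial.aeval_monomial, ← Algebra.smul_def, LinearMap.smul_apply,
        Matrix.vecMul_smul, Submodule.coe_smul, hpow]
  have hvN : v ∈ N := (memN v).2 hv
  -- By Cayley–Hamilton `q(A)` kills the row `v`. Vanishing of the determinant then transfers this
  -- to a column `u`.
  have hdetq : (Polynomial.aeval A q).det = 0 := by
    refine Matrix.exists_vecMul_eq_zero_iff.1 ⟨v, hv0, ?_⟩
    rw [← haeval q ⟨v, hvN⟩, hq, LinearMap.aeval_self_charpoly]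
    rfl
  obtain ⟨u, hu0, hu⟩ := Matrix.exists_mulVec_eq_zero_iff.2 hdetq
  obtain ⟨c, hc⟩ := hunit
  -- On the kernel of `q(A)` the matrix `A` is invertible, with inverse a polynomial in `A`.
  let B : Matrix (Fin n) (Fin n) ℤ := -((↑c⁻¹ : ℤ) • Polynomial.aeval A q.divX)
  have hAq : Polynomial.aeval A q = A * Polynomial.aeval A q.divX + (c : ℤ) • 1 := by
    conv_lhs => rw [← Polynomial.X_mul_divX_add q]
    simp [hc]
  have hAB : u = A *ᵥ (B *ᵥ u) := by
    have h1 : (A * Polynomial.aeval A q.divX) *ᵥ u = -((c : ℤ) • u) := by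
      rw [hAq, Matrix.add_mulVec, Matrix.smul_mulVec, Matrix.one_mulVec] at hu
      exact eq_neg_of_add_eq_zero_left hu
    rw [Matrix.mulVec_mulVec]
    simp only [B, mul_neg, Matrix.neg_mulVec, Matrix.mul_smul, Matrix.smul_mulVec, h1, smul_neg,
      neg_neg, smul_smul, Units.inv_mul, one_smul]
  have hcomm : Commute A B := by
    refine Commute.neg_right (Commute.smul_right ?_ _)
    simpa using (Commute.all Polynomial.X q.divX).map (Polynomial.aeval A)
  have hk (k : ℕ) : u = A ^ k *ᵥ (B ^ k *ᵥ u) := by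
    rw [Matrix.mulVec_mulVec] at hAB ⊢
    rw [← hcomm.mul_pow]
    induction k with
    | zero => simp
    | succ k ih => rw [pow_succ, ← Matrix.mulVec_mulVec, ← hAB, ← ih]
  apply hu0
  rw [← Submodule.mem_bot ℤ, ← hA, Submodule.mem_iInf]
  exact fun k => ⟨B ^ (k + 1) *ᵥ u, (hk (k + 1)).symm⟩

/-! ### Semilinear maps and dimension -/

/-- Let `θ` be an additive endomorphism of a nonzero finite-dimensional vector space that is
semilinear over an endomorphism `ψ` of the field. If the range of `θ` contains a spanning set `X`
as well as `b • X`, then `b` lies in the range of `ψ`. -/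
theorem Module.mem_fieldRange_of_semilinear {L V : Type*} [Field L] [AddCommGroup V] [Module L V]
    [FiniteDimensional L V] [Nontrivial V] (ψ : L →+* L) (θ : V →+ V)
    (hθ : ∀ (l : L) (v : V), θ (l • v) = ψ l • θ v) {X : Set V} (hX : Submodule.span L X = ⊤)
    {b : L} (h1 : ∀ x ∈ X, x ∈ θ.range) (hb : ∀ x ∈ X, b • x ∈ θ.range) : b ∈ ψ.fieldRange := by
  classical
  by_contra hbF
  let B := Module.Basis.ofSpan hX.ge
  have hBX (i) : B i ∈ X := Module.Basis.ofSpan_subset hX.ge ⟨i, rfl⟩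
  have : Finite _ := Module.Finite.finite_basis B
  have := Fintype.ofFinite ((linearIndepOn_empty L (id : V → V)).extend (Set.empty_subset X))
  have hli : LinearIndependent ψ.fieldRange ![(1 : L), b] := by
    rw [LinearIndependent.pair_iff]
    intro s t h
    have ht : t = 0 := by
      by_contra ht
      apply hbF
      have ht' : (t : L) ≠ 0 := by simpa using ht
      have h' : (s : L) + t * b = 0 := by simpa [Subfield.smul_def] using h
      have : b = ((-s / t : ψ.fieldRange) : L) := by
        push_cast
        field_simp
        linear_combination h'
      exact this ▸ Subtype.property _
    subst ht
    simpa [Subfield.smul_def] using h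
  have hli2 := linearIndependent_smul hli B.linearIndependent
  have hW (v : V) : θ v ∈ Submodule.span ψ.fieldRange (Set.range fun i => θ (B i)) := by
    rw [← B.sum_repr v, map_sum]
    refine Submodule.sum_mem _ fun i _ => ?_
    rw [hθ]
    exact Submodule.smul_mem _ (⟨ψ (B.repr v i), _, rfl⟩ : ψ.fieldRange)
      (Submodule.subset_span ⟨i, rfl⟩)
  -- With `d = dim V`, the `2d` vectors `B i`, `b • B i` are independent over `ψ(L)` but lie in the
  -- span of the `d` vectors `θ (B i)`; yet `d > 0`.
  have hle := linearIndependent_le_span_aux' _ hli2 (Set.range fun i => θ (B i)) (by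
    rintro _ ⟨⟨k, i⟩, rfl⟩
    fin_cases k
    · obtain ⟨v, hv⟩ := h1 _ (hBX i)
      simpa [← hv] using hW v
    · obtain ⟨v, hv⟩ := hb _ (hBX i)
      simpa [← hv] using hW v)
  have hWcard := Fintype.card_range_le (fun i => θ (B i))
  have hne := B.index_nonempty
  have := Fintype.card_pos (α := (linearIndepOn_empty L (id : V → V)).extend (Set.empty_subset X))
  rw [Fintype.card_prod, Fintype.card_fin] at hle
  omega

/-! ### Orders and integrality -/

/-- The order of `y` is the length of `B/(y)`, which is finite, and zero only if `y` is a unit. -/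
theorem Ring.ordFrac_ne_one {B K : Type*} [CommRing B] [IsDomain B] [IsNoetherianRing B]
    [Ring.KrullDimLE 1 B] [Field K] [Algebra B K] [IsFractionRing B K] {y : B} (hy0 : y ≠ 0)
    (hy : ¬IsUnit y) : Ring.ordFrac B (algebraMap B K y) ≠ 1 := by
  rw [Ring.ordFrac_eq_ord _ hy0]
  obtain ⟨m, hm⟩ := ENat.ne_top_iff_exists.1
    (Ring.ord_ne_top (mem_nonZeroDivisors_of_ne_zero hy0))
  rw [Ring.ordMonoidWithZeroHom_eq_coe _ (mem_nonZeroDivisors_of_ne_zero hy0) hm.symm]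
  intro h
  have hm0 : m = 0 := by
    rw [← WithZero.coe_one, WithZero.coe_inj] at h
    have : (m : ℤ) = 0 := congrArg Multiplicative.toAdd h
    exact_mod_cast this
  subst hm0
  rw [Ring.ord, Nat.cast_zero, eq_comm, Module.length_eq_zero_iff,
    Ideal.Quotient.subsingleton_iff, Ideal.span_singleton_eq_top] at hm
  exact hy hm

theorem Ring.ordFrac_eq_one {B K : Type*} [CommRing B] [IsDomain B] [IsNoetherianRing B]
    [Ring.KrullDimLE 1 B] [Field K] [Algebra B K] [IsFractionRing B K] {y : B}
    (hy : IsUnit y) : Ring.ordFrac B (algebraMap B K y) = 1 := by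
  rw [Ring.ordFrac_eq_ord _ hy.ne_zero, Ring.ordMonoidWithZeroHom_eq_coe (n := 0) _
    (mem_nonZeroDivisors_of_ne_zero hy.ne_zero) (by simpa using Ring.ord_of_isUnit hy)]
  rfl

/-- A nonunit of a Noetherian domain `E` has nontrivial order at a suitable height one prime. -/
theorem IsNoetherianRing.exists_hom_ne_one {E L : Type*} [CommRing E] [IsDomain E]
    [IsNoetherianRing E] [Field L] [Algebra E L] [IsFractionRing E L] {y : E} (hy0 : y ≠ 0)
    (hy : ¬IsUnit y) :
    ∃ h : L →*₀ ℤᵐ⁰, (∀ e : E, IsUnit e → h (algebraMap E L e) = 1) ∧ h (algebraMap E L y) ≠ 1 := by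
  obtain ⟨⟨q, hq⟩⟩ := (Ideal.span {y}).nonempty_minimalPrimes
    (by rwa [Ne, Ideal.span_singleton_eq_top])
  have hqp := hq.isPrime
  -- Krull's principal ideal theorem makes the local ring at `q` of dimension at most one, where
  -- `Ring.ordFrac` applies.
  have hht := Ideal.height_le_one_of_isPrincipal_of_mem_minimalPrimes _ q hq
  let B := Localization.subalgebra.ofField L q.primeCompl q.primeCompl_le_nonZeroDivisors
  have : IsLocalization.AtPrime B q :=
    Localization.subalgebra.isLocalization_ofField L q.primeCompl q.primeCompl_le_nonZeroDivisors
  have : IsFractionRing B L := inferInstance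
  have : IsNoetherianRing B := IsLocalization.isNoetherianRing q.primeCompl B inferInstance
  have : Ring.KrullDimLE 1 B := by
    rw [Ring.krullDimLE_iff, IsLocalization.AtPrime.ringKrullDim_eq_height q B]
    exact_mod_cast hht
  refine ⟨Ring.ordFrac B, fun e he => ?_, ?_⟩
  · rw [IsScalarTower.algebraMap_apply E B L]
    exact Ring.ordFrac_eq_one (he.map _)
  · rw [IsScalarTower.algebraMap_apply E B L]
    refine Ring.ordFrac_ne_one ?_ ?_
    · rwa [Ne, IsLocalization.to_map_eq_zero_iff B q.primeCompl_le_nonZeroDivisors]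
    · rw [IsLocalization.AtPrime.isUnit_to_map_iff B q y]
      exact fun h => h (hq.1.2 (Ideal.mem_span_singleton_self y))

/-- Integrality over a Noetherian ring inside a finitely generated field extension is detected by
discrete homomorphisms. -/
theorem exists_hom_ne_one_of_not_isIntegral {R L : Type*} [CommRing R] [IsNoetherianRing R]
    [Field L] [Algebra R L] {s : Set L} (hs : s.Finite)
    (hgen : Subfield.closure (Set.range (algebraMap R L) ∪ s) = ⊤) {x : L}
    (hx : ¬IsIntegral R x) :
    ∃ h : L →*₀ ℤᵐ⁰, (∀ r : R, IsUnit r → h (algebraMap R L r) = 1) ∧ h x ≠ 1 := by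
  classical
  have hx0 : x ≠ 0 := by
    rintro rfl
    exact hx isIntegral_zero
  obtain ⟨V, hV, hxV⟩ := Subring.exists_le_valuationSubring_of_isIntegrallyClosedIn
    (R := (integralClosure R L).toSubring) (x := x) hx
  have hRV (r : R) : algebraMap R L r ∈ V :=
    hV (show algebraMap R L r ∈ integralClosure R L from isIntegral_algebraMap)
  have hxV' : x⁻¹ ∈ V := (V.mem_or_inv_mem x).resolve_left hxV
  -- Keeping whichever of `y`, `y⁻¹` lies in `V` makes `E` a finitely generated subring of `V` with
  -- fraction field `L`. Since `x ∉ V`, `x⁻¹` is a nonunit of `E`.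
  let E : Subalgebra R L :=
    Algebra.adjoin R (insert x⁻¹ ((fun y => if y ∈ V then y else y⁻¹) '' s))
  have hEV : ∀ y ∈ E, y ∈ V := by
    intro y hy
    induction hy using Algebra.adjoin_induction with
    | mem y hy =>
      obtain rfl | ⟨z, -, rfl⟩ := hy
      · exact hxV'
      · dsimp only
        split_ifs with hz
        · exact hz
        · exact (V.mem_or_inv_mem z).resolve_left hz
    | algebraMap r => exact hRV r
    | add a b _ _ ha hb => exact add_mem ha hb
    | mul a b _ _ ha hb => exact mul_mem ha hb
  have hft : Algebra.FiniteType R E :=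
    E.fg_iff_finiteType.1 (Subalgebra.fg_def.2 ⟨_, (hs.image _).insert _, rfl⟩)
  have : IsNoetherianRing E := Algebra.FiniteType.isNoetherianRing R E
  have hclosure : Subfield.closure (E : Set L) = ⊤ := by
    rw [eq_top_iff, ← hgen, Subfield.closure_le]
    rintro z (⟨r, rfl⟩ | hz)
    · exact Subfield.subset_closure (E.algebraMap_mem r)
    · have : (if z ∈ V then z else z⁻¹) ∈ Subfield.closure (E : Set L) :=
        Subfield.subset_closure (Algebra.subset_adjoin (Or.inr ⟨z, hz, rfl⟩))
      split_ifs at this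
      · exact this
      · simpa using inv_mem this
  have : IsFractionRing E L := IsFractionRing.of_field E L fun z => by
    have hz : z ∈ Subfield.closure (E : Set L) := hclosure ▸ Subfield.mem_top z
    have hE : Subring.closure (E : Set L) = E.toSubring := Subring.closure_eq E.toSubring
    rw [Subfield.mem_closure_iff, hE] at hz
    obtain ⟨a, ha, b, hb, rfl⟩ := hz
    exact ⟨⟨a, ha⟩, ⟨b, hb⟩, rfl⟩
  let y : E := ⟨x⁻¹, Algebra.subset_adjoin (Or.inl rfl)⟩
  have hyu : ¬IsUnit y := by
    intro h
    obtain ⟨z, hz⟩ := h.exists_right_inv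
    have hz' : x⁻¹ * (z : L) = 1 := congrArg Subtype.val hz
    have : (z : L) = x := by field_simp at hz'; exact hz'
    exact hxV (this ▸ hEV z z.2)
  obtain ⟨h, h1, h2⟩ := IsNoetherianRing.exists_hom_ne_one (L := L) (y := y)
    (fun h0 => inv_ne_zero hx0 (congrArg Subtype.val h0)) hyu
  refine ⟨h, fun r hr => h1 (algebraMap R E r) (hr.map _), fun hhx => h2 ?_⟩
  change h x⁻¹ = 1
  rw [map_inv₀, hhx, inv_one]

/-! ### Integrality from an automorphism of the field -/

theorem Matrix.iInf_range_pow_mulVecLin_eq_bot {n : ℕ} {A : Matrix (Fin n) (Fin n) ℤ}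
    (hA : ⨅ k : ℕ, LinearMap.range (A ^ (k + 1)).mulVecLin = ⊥) {m : ℕ} (hm : 0 < m) :
    ⨅ k : ℕ, LinearMap.range ((A ^ m) ^ (k + 1)).mulVecLin = ⊥ := by
  rw [eq_bot_iff, ← hA]
  refine iInf_mono fun k => ?_
  rintro _ ⟨u, rfl⟩
  obtain ⟨l, rfl⟩ := Nat.exists_eq_add_of_lt hm
  refine ⟨A ^ (l * (k + 1)) *ᵥ u, ?_⟩
  simp only [Matrix.mulVecLin_apply, Matrix.mulVec_mulVec, ← pow_add, ← pow_mul]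
  ring_nf

theorem AddMonoidHom.apply_eq_dotProduct {n : ℕ} (f : (Fin n → ℤ) →+ ℤ) (u : Fin n → ℤ) :
    f u = (fun i => f (Pi.single i 1)) ⬝ᵥ u := by
  conv_lhs => rw [← Finset.univ_sum_single u, map_sum]
  refine Finset.sum_congr rfl fun i _ => ?_
  rw [← mul_one (u i), ← smul_eq_mul, Pi.single_smul, map_zsmul, smul_eq_mul, smul_eq_mul, mul_one,
    mul_comm]

/-- Let `ψ` be an automorphism of a field `L` that preserves the image of the Noetherian ring `R`
and acts on a multiplicative family `t` of generators as the matrix `A`, up to units of `R`. Then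
the family `t` is integral over `R`. -/
theorem isIntegral_of_ringEquiv {R L : Type*} [CommRing R] [IsNoetherianRing R]
    [Field L] [Algebra R L] {n : ℕ} {A : Matrix (Fin n) (Fin n) ℤ} (hdet : A.det ≠ 0)
    (hA : ⨅ k : ℕ, LinearMap.range (A ^ (k + 1)).mulVecLin = ⊥)
    (t : Multiplicative (Fin n → ℤ) →* L)
    (hgen : Subfield.closure (Set.range (algebraMap R L) ∪
      Set.range fun i => t (.ofAdd (Pi.single i 1))) = ⊤)
    (ψ : L ≃+* L)
    (hR : ∀ r : R, IsUnit r → ∃ r' : R, IsUnit r' ∧ ψ (algebraMap R L r') = algebraMap R L r)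
    (ht : ∀ u : Fin n → ℤ, ∃ r : R, IsUnit r ∧
      ψ (t (.ofAdd u)) = algebraMap R L r * t (.ofAdd (A *ᵥ u)))
    (u : Fin n → ℤ) : IsIntegral R (t (.ofAdd u)) := by
  by_contra hx
  obtain ⟨h, h1, h2⟩ := exists_hom_ne_one_of_not_isIntegral (Set.finite_range _) hgen hx
  have ht0 (h : L →*₀ ℤᵐ⁰) (u : Fin n → ℤ) : h (t (.ofAdd u)) ≠ 0 := by
    have : IsUnit (t (.ofAdd u)) := (Group.isUnit (Multiplicative.ofAdd u)).map t
    exact (this.map h).ne_zero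
  let F (h : L →*₀ ℤᵐ⁰) : (Fin n → ℤ) →+ ℤ := AddMonoidHom.mk' (fun u => log (h (t (.ofAdd u))))
    fun u v => by rw [ofAdd_add, map_mul, map_mul, log_mul (ht0 h u) (ht0 h v)]
  have key (k : ℕ) : ∃ h' : L →*₀ ℤᵐ⁰, (∀ r : R, IsUnit r → h' (algebraMap R L r) = 1) ∧
      ∀ u, h (t (.ofAdd u)) = h' (t (.ofAdd (A ^ k *ᵥ u))) := by
    induction k with
    | zero => exact ⟨h, h1, fun u => by simp⟩
    | succ k ih =>
      obtain ⟨h', h1', h2'⟩ := ih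
      -- The new homomorphism is `h ∘ ψ⁻ᵏ⁻¹`; the unit factors from `R` are invisible to it.
      refine ⟨h'.comp (ψ.symm : L →+* L).toMonoidWithZeroHom, fun r hr => ?_, fun u => ?_⟩
      · obtain ⟨r', hr', e⟩ := hR r hr
        change h' (ψ.symm _) = 1
        rw [← e, RingEquiv.symm_apply_apply, h1' r' hr']
      · rw [h2']
        change _ = h' (ψ.symm _)
        obtain ⟨r, hr, e⟩ := ht (A ^ k *ᵥ u)
        obtain ⟨r', hr', e'⟩ := hR r hr
        rw [Matrix.mulVec_mulVec, ← pow_succ', ← e', ← RingEquiv.eq_symm_apply, map_mul,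
          RingEquiv.symm_apply_apply] at e
        rw [e, map_mul, h1' r' hr', one_mul]
  have hv : (fun i => F h (Pi.single i 1)) = 0 := by
    refine Matrix.eq_zero_of_forall_exists_vecMul_pow hdet hA fun k => ?_
    obtain ⟨h', -, h2'⟩ := key k
    refine ⟨fun i => F h' (Pi.single i 1), funext fun i => ?_⟩
    have : F h (Pi.single i 1) = F h' (A ^ k *ᵥ Pi.single i 1) := congrArg log (h2' _)
    rw [this, AddMonoidHom.apply_eq_dotProduct, Matrix.dotProduct_mulVec, dotProduct_single_one]
  have h0 : F h u = 0 := by rw [AddMonoidHom.apply_eq_dotProduct, hv, zero_dotProduct]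
  apply h2
  rw [← exp_log (ht0 h u)]
  change exp (F h u) = 1
  rw [h0, exp_zero]

/-! ### Passage to minimal primes and residue fields -/

/-- The product of monic equations modulo the finitely many minimal primes takes a value in the
radical of `I`; a power of it is a monic equation modulo `I`. -/
theorem Ideal.Quotient.isIntegral_mk_of_minimalPrimes {R S : Type*} [CommRing R] [CommRing S]
    [IsNoetherianRing S] [Algebra R S] (I : Ideal S) (s : S)
    (h : ∀ (P : Ideal S) [P.IsPrime], P ∈ I.minimalPrimes →
      IsIntegral R (algebraMap S P.ResidueField s)) :
    IsIntegral R (Ideal.Quotient.mk I s) := by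
  have h' : ∀ P ∈ I.minimalPrimes, ∃ p : Polynomial R, p.Monic ∧ Polynomial.aeval s p ∈ P := by
    intro P hP
    have := hP.isPrime
    obtain ⟨p, hp, hps⟩ := h P hP
    refine ⟨p, hp, ?_⟩
    rw [← Ideal.algebraMap_residueField_eq_zero, ← Polynomial.aeval_algebraMap_apply]
    exact hps
  choose! p hp hps using h'
  have hfin := Ideal.finite_minimalPrimes_of_isNoetherianRing S I
  have hrad : Polynomial.aeval s (∏ P ∈ hfin.toFinset, p P) ∈ I.radical := by
    rw [← Ideal.sInf_minimalPrimes, Submodule.mem_sInf]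
    intro P hP
    rw [map_prod]
    exact Ideal.mem_of_dvd P (Finset.dvd_prod_of_mem _ (hfin.mem_toFinset.2 hP)) (hps P hP)
  obtain ⟨k, hk⟩ := hrad
  refine ⟨(∏ P ∈ hfin.toFinset, p P) ^ k, (Polynomial.monic_prod_of_monic _ _ fun P hP =>
    hp P (hfin.mem_toFinset.1 hP)).pow k, ?_⟩
  rw [← Polynomial.aeval_def, ← Ideal.Quotient.algebraMap_eq, Polynomial.aeval_algebraMap_apply,
    map_pow, Ideal.Quotient.algebraMap_eq, Ideal.Quotient.eq_zero_iff_mem]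
  exact hk

theorem MvLaurent.finite_of_isIntegral {R : Type*} [CommRing R] {n : ℕ}
    {M : Type*} [AddCommGroup M] [Module (MvLaurent n R) M] [Module R M]
    [IsScalarTower R (MvLaurent n R) M] [Module.Finite (MvLaurent n R) M]
    (h : ∀ u : Fin n → ℤ, IsIntegral R (Ideal.Quotient.mk (Module.annihilator (MvLaurent n R) M)
      (AddMonoidAlgebra.single u 1))) : Module.Finite R M := by
  let I := Module.annihilator (MvLaurent n R) M
  let _ : Module (MvLaurent n R ⧸ I) M := Module.quotientAnnihilator
  have : IsScalarTower (MvLaurent n R) (MvLaurent n R ⧸ I) M := ⟨fun s q x => by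
    obtain ⟨q, rfl⟩ := Ideal.Quotient.mk_surjective q
    exact smul_assoc s q x⟩
  have : IsScalarTower R (MvLaurent n R ⧸ I) M := ⟨fun r q x => by
    obtain ⟨q, rfl⟩ := Ideal.Quotient.mk_surjective q
    exact smul_assoc r q x⟩
  have : Module.Finite (MvLaurent n R ⧸ I) M :=
    Module.Finite.of_restrictScalars_finite (MvLaurent n R) _ _
  have : Algebra.IsIntegral R (MvLaurent n R ⧸ I) := ⟨fun q => by
    obtain ⟨q, rfl⟩ := Ideal.Quotient.mk_surjective q
    induction q using AddMonoidAlgebra.induction_linear with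
    | zero => rw [map_zero]; exact isIntegral_zero
    | add a b ha hb => rw [map_add]; exact ha.add hb
    | single u r =>
      have : AddMonoidAlgebra.single u r
          = r • (AddMonoidAlgebra.single u 1 : MvLaurent n R) := by simp
      rw [this, ← Ideal.Quotient.mk_eq_mk, Submodule.Quotient.mk_smul]
      exact (h u).smul r⟩
  have : Module.Finite R (MvLaurent n R ⧸ I) := Algebra.IsIntegral.finite
  exact Module.Finite.trans (MvLaurent n R ⧸ I) M

/-- If `M` is a finite module with `P` in its support and `θ` is a surjective additive
endomorphism of `M`, semilinear over a ring endomorphism `Φ` under which `P` is stable, then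
`Φ` induces an automorphism of the residue field of `P`. -/
theorem Ideal.ResidueField.map_surjective_of_semilinear {S M : Type*} [CommRing S]
    [AddCommGroup M] [Module S M] [Module.Finite S M] (Φ : S →+* S) (θ : M →+ M)
    (hθs : Function.Surjective θ) (hθ : ∀ (s : S) (x : M), θ (s • x) = Φ s • θ x)
    (P : Ideal S) [P.IsPrime] (hPM : Module.annihilator S M ≤ P) (hP : P = P.comap Φ) :
    Function.Surjective (Ideal.ResidueField.map P P Φ hP) := by
  set ψ := Ideal.ResidueField.map P P Φ hP
  let L := P.ResidueField
  have : Nontrivial (L ⊗[S] M) := by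
    refine (Module.mem_support_iff_nontrivial_residueField_tensorProduct ⟨P, ‹_›⟩).1 ?_
    rw [Module.support_eq_zeroLocus]
    exact hPM
  -- The map `l ⊗ x ↦ ψ l ⊗ θ x` is balanced because `ψ` extends `Φ`.
  let Θ : L ⊗[S] M →+ L ⊗[S] M := TensorProduct.liftAddHom
    (AddMonoidHom.mk' (fun l => AddMonoidHom.mk' (fun x => ψ l ⊗ₜ[S] θ x)
      fun x y => by rw [map_add, TensorProduct.tmul_add])
      fun l l' => by ext x; simp [TensorProduct.add_tmul])
    fun s l x => by
      have h : ψ (algebraMap S L s) = algebraMap S L (Φ s) :=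
        Ideal.ResidueField.map_algebraMap P P Φ hP s
      simp only [AddMonoidHom.mk'_apply]
      rw [hθ, Algebra.smul_def, map_mul, h, ← Algebra.smul_def, TensorProduct.smul_tmul]
  have hΘ (l : L) (x : M) : Θ (l ⊗ₜ x) = ψ l ⊗ₜ θ x := rfl
  have hΘs (l : L) (v : L ⊗[S] M) : Θ (l • v) = ψ l • Θ v := by
    induction v with
    | zero => simp
    | add a b ha hb => simp [ha, hb]
    | tmul a x => simp [TensorProduct.smul_tmul', hΘ]
  have hspan : Submodule.span L (Set.range fun x : M => (1 : L) ⊗ₜ[S] x) = ⊤ := by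
    rw [eq_top_iff]
    rintro v -
    induction v with
    | zero => exact zero_mem _
    | add a b ha hb => exact add_mem ha hb
    | tmul a x =>
      rw [← mul_one a, ← smul_eq_mul, ← TensorProduct.smul_tmul']
      exact Submodule.smul_mem _ _ (Submodule.subset_span ⟨x, rfl⟩)
  have hone (x : M) : (1 : L) ⊗ₜ[S] x ∈ Θ.range := by
    obtain ⟨y, rfl⟩ := hθs x
    exact ⟨1 ⊗ₜ y, by rw [hΘ, map_one]⟩
  -- Both `1 ⊗ x` and `s • (1 ⊗ x) = 1 ⊗ (s • x)` are values of `Θ`, as `θ` is onto.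
  have hS (s : S) : algebraMap S L s ∈ ψ.fieldRange := by
    refine Module.mem_fieldRange_of_semilinear ψ Θ hΘs hspan ?_ ?_
    · rintro _ ⟨x, rfl⟩
      exact hone x
    · rintro _ ⟨x, rfl⟩
      have : algebraMap S L s • (1 : L) ⊗ₜ[S] x = 1 ⊗ₜ (s • x) := by
        rw [TensorProduct.smul_tmul', smul_eq_mul, ← Algebra.smul_def, TensorProduct.smul_tmul]
      exact this ▸ hone _
  intro z
  obtain ⟨a, b, -, rfl⟩ := IsFractionRing.div_surjective (S ⧸ P) z
  obtain ⟨a, rfl⟩ := Ideal.Quotient.mk_surjective a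
  obtain ⟨b, rfl⟩ := Ideal.Quotient.mk_surjective b
  exact div_mem (hS a) (hS b)

/-- A prime minimal over an ideal stable under `φ` is stable under some power of `φ`. -/
theorem Ideal.exists_comap_pow_eq_of_mem_minimalPrimes {S : Type*} [CommRing S]
    [IsNoetherianRing S] (φ : S →+* S) {I : Ideal S} (hI : I.comap φ = I) {P : Ideal S}
    (hP : P ∈ I.minimalPrimes) : ∃ m : ℕ, 0 < m ∧ P = P.comap (φ ^ m) := by
  have h : ∀ Q : I.minimalPrimes, ∃ Q' : I.minimalPrimes, (Q' : Ideal S).comap φ = Q := by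
    rintro ⟨Q, hQ⟩
    obtain ⟨Q', hQ', e⟩ := Ideal.exists_minimalPrimes_comap_eq (I := I) φ Q (by rwa [hI])
    exact ⟨⟨Q', hQ'⟩, e⟩
  choose c hc using h
  have : Finite I.minimalPrimes := Ideal.finite_minimalPrimes_of_isNoetherianRing S I
  -- Pulling back recovers `Q` from `c Q`. An injective self-map of a finite set has only periodic
  -- points.
  have hcinj : Function.Injective c := fun Q Q' e => Subtype.ext (by rw [← hc Q, e, hc])
  obtain ⟨m, hm, hper⟩ := hcinj.mem_periodicPts ⟨P, hP⟩
  have key (k : ℕ) (Q : I.minimalPrimes) : ((c^[k] Q : Ideal S)).comap (φ ^ k) = Q := by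
    induction k generalizing Q with
    | zero => exact Ideal.comap_id _
    | succ k ih =>
      rw [pow_succ, Function.iterate_succ_apply]
      change Ideal.comap (RingHom.comp (φ ^ k) φ) _ = _
      rw [← Ideal.comap_comap, ih, hc]
  refine ⟨m, hm, ?_⟩
  have := key m ⟨P, hP⟩
  rw [hper] at this
  exact this.symm

theorem AddEquiv.exists_semilinear_pow {S M : Type*} [CommRing S] [AddCommGroup M] [Module S M]
    (φ : S →+* S) (η : M ≃+ M) (hη : ∀ (s : S) (x : M), η (s • x) = φ s • η x) (m : ℕ) :
    ∃ θ : M ≃+ M, ∀ (s : S) (x : M), θ (s • x) = (φ ^ m) s • θ x := by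
  induction m with
  | zero => exact ⟨AddEquiv.refl M, fun s x => rfl⟩
  | succ m ih =>
    obtain ⟨θ, hθ⟩ := ih
    refine ⟨η.trans θ, fun s x => ?_⟩
    rw [AddEquiv.trans_apply, AddEquiv.trans_apply, hη, hθ, pow_succ]
    rfl

/-! ### Monomials in the Laurent polynomial ring -/

namespace MvLaurent

variable {R : Type*} [CommRing R] {n : ℕ}

theorem algebraMap_injective : Function.Injective (algebraMap R (MvLaurent n R)) := by
  exact FaithfulSMul.algebraMap_injective _ _

/-- The monomials as units of the Laurent polynomial ring. -/
noncomputable def unitMonomial (n : ℕ) (R : Type*) [CommRing R] :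
    Multiplicative (Fin n → ℤ) →* (MvLaurent n R)ˣ :=
  (AddMonoidAlgebra.of R (Fin n → ℤ)).toHomUnits

theorem coe_unitMonomial (u : Fin n → ℤ) :
    (unitMonomial n R (.ofAdd u) : MvLaurent n R) = AddMonoidAlgebra.single u 1 := rfl

theorem T_eq_unitMonomial (i : Fin n) : T R i = unitMonomial n R (.ofAdd (Pi.single i 1)) :=
  Units.ext rfl

theorem ofAdd_eq_prod (u : Fin n → ℤ) : Multiplicative.ofAdd u
    = ∏ i : Fin n, Multiplicative.ofAdd (Pi.single i (1 : ℤ) : Fin n → ℤ) ^ u i := by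
  simp only [← ofAdd_zsmul, ← ofAdd_sum, ← Pi.single_smul, smul_eq_mul, mul_one,
    Finset.univ_sum_single]

/-- The quotient of `u ↦ φ(tᵘ)` by `u ↦ t^(A u)` is a homomorphism into the units, so it lands in
the units of `R` once it does so on the standard basis. -/
theorem exists_map_single (A : Matrix (Fin n) (Fin n) ℤ) (φ : MvLaurent n R →+* MvLaurent n R)
    (g : Fin n → Rˣ)
    (hφT : ∀ j : Fin n, φ (MvLaurent.T R j)
      = algebraMap R (MvLaurent n R) (g j)
        * ((∏ i : Fin n, MvLaurent.T R i ^ A i j : (MvLaurent n R)ˣ) : MvLaurent n R))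
    (u : Fin n → ℤ) : ∃ r : R, IsUnit r ∧ φ (AddMonoidAlgebra.single u 1)
      = algebraMap R (MvLaurent n R) r * AddMonoidAlgebra.single (A *ᵥ u) 1 := by
  let ι : Rˣ →* (MvLaurent n R)ˣ := Units.map (algebraMap R (MvLaurent n R) : _ →* _)
  let Ahom : Multiplicative (Fin n → ℤ) →* Multiplicative (Fin n → ℤ) :=
    AddMonoidHom.toMultiplicative A.mulVecLin.toAddMonoidHom
  let F : Multiplicative (Fin n → ℤ) →* (MvLaurent n R)ˣ :=
    (Units.map (φ : _ →* _)).comp (unitMonomial n R) / (unitMonomial n R).comp Ahom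
  have hgen (j : Fin n) : F (.ofAdd (Pi.single j 1)) ∈ ι.range := by
    refine ⟨g j, ?_⟩
    rw [MonoidHom.div_apply, eq_div_iff_mul_eq']
    refine Units.ext ?_
    have h1 : unitMonomial n R (Ahom (.ofAdd (Pi.single j 1))) = ∏ i, T R i ^ A i j := by
      have : Ahom (.ofAdd (Pi.single j 1)) = .ofAdd (A.col j) := by
        change Multiplicative.ofAdd (A *ᵥ Pi.single j 1) = _
        rw [Matrix.mulVec_single_one]
      rw [this, ofAdd_eq_prod, map_prod]
      exact Finset.prod_congr rfl fun i _ => by rw [map_zpow, T_eq_unitMonomial]; rfl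
    rw [MonoidHom.comp_apply, h1]
    exact (hφT j).symm
  have hu : F (.ofAdd u) ∈ ι.range := by
    rw [ofAdd_eq_prod, map_prod]
    exact Subgroup.prod_mem _ fun i _ => by
      rw [map_zpow]
      exact Subgroup.zpow_mem _ (hgen i) _
  obtain ⟨r, hr⟩ := hu
  rw [MonoidHom.div_apply, eq_div_iff_mul_eq'] at hr
  refine ⟨r, r.isUnit, ?_⟩
  exact (congrArg Units.val hr).symm

theorem exists_pow_map_single (A : Matrix (Fin n) (Fin n) ℤ)
    (φ : MvLaurent n R →+* MvLaurent n R)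
    (hR : ∀ r : R, IsUnit r → ∃ r' : R, IsUnit r' ∧
      φ (algebraMap R (MvLaurent n R) r) = algebraMap R (MvLaurent n R) r')
    (h : ∀ u : Fin n → ℤ, ∃ r : R, IsUnit r ∧ φ (AddMonoidAlgebra.single u 1)
      = algebraMap R (MvLaurent n R) r * AddMonoidAlgebra.single (A *ᵥ u) 1)
    (m : ℕ) (u : Fin n → ℤ) : ∃ r : R, IsUnit r ∧ (φ ^ m) (AddMonoidAlgebra.single u 1)
      = algebraMap R (MvLaurent n R) r * AddMonoidAlgebra.single (A ^ m *ᵥ u) 1 := by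
  induction m with
  | zero => exact ⟨1, isUnit_one, by simp⟩
  | succ m ih =>
    obtain ⟨r, hr, e⟩ := ih
    obtain ⟨r', hr', e'⟩ := hR r hr
    obtain ⟨a, ha, ea⟩ := h (A ^ m *ᵥ u)
    refine ⟨r' * a, hr'.mul ha, ?_⟩
    rw [pow_succ', RingHom.mul_def, RingHom.comp_apply, e, map_mul, e', ea, Matrix.mulVec_mulVec,
      ← pow_succ', map_mul, mul_assoc]

theorem exists_pow_map_algebraMap_eq (φ : MvLaurent n R →+* MvLaurent n R)
    (hR : ∀ r : R, IsUnit r → ∃ r' : R, IsUnit r' ∧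
      φ (algebraMap R (MvLaurent n R) r') = algebraMap R (MvLaurent n R) r)
    (m : ℕ) (r : R) (hr : IsUnit r) : ∃ r' : R, IsUnit r' ∧
      (φ ^ m) (algebraMap R (MvLaurent n R) r') = algebraMap R (MvLaurent n R) r := by
  induction m generalizing r with
  | zero => exact ⟨r, hr, rfl⟩
  | succ m ih =>
    obtain ⟨a, ha, e⟩ := hR r hr
    obtain ⟨b, hb, e'⟩ := ih a ha
    refine ⟨b, hb, ?_⟩
    rw [pow_succ', RingHom.mul_def, RingHom.comp_apply, e', e]

theorem closure_residueField_eq_top (P : Ideal (MvLaurent n R)) [P.IsPrime] :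
    Subfield.closure (Set.range (algebraMap R P.ResidueField) ∪ Set.range fun i : Fin n =>
      algebraMap (MvLaurent n R) P.ResidueField
        (AddMonoidAlgebra.single (Pi.single i 1) 1)) = ⊤ := by
  set C := Subfield.closure (Set.range (algebraMap R P.ResidueField) ∪ Set.range fun i : Fin n =>
    algebraMap (MvLaurent n R) P.ResidueField (AddMonoidAlgebra.single (Pi.single i 1) 1)) with hC
  have hmon (u : Fin n → ℤ) :
      algebraMap (MvLaurent n R) P.ResidueField (AddMonoidAlgebra.single u 1) ∈ C := by
    rw [← coe_unitMonomial, ofAdd_eq_prod, map_prod, Units.coe_prod, map_prod]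
    refine prod_mem fun i _ => ?_
    let f : (MvLaurent n R)ˣ →* P.ResidueFieldˣ :=
      Units.map (algebraMap (MvLaurent n R) P.ResidueField : _ →* _)
    have : algebraMap (MvLaurent n R) P.ResidueField
        (unitMonomial n R (.ofAdd (Pi.single i 1) ^ u i) : (MvLaurent n R)ˣ)
        = algebraMap (MvLaurent n R) P.ResidueField
          (AddMonoidAlgebra.single (Pi.single i 1) 1) ^ u i := by
      change ((f _ : P.ResidueFieldˣ) : P.ResidueField) = _
      rw [map_zpow, map_zpow, Units.val_zpow_eq_zpow_val]
      rfl
    rw [this]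
    exact zpow_mem (Subfield.subset_closure (Or.inr ⟨i, rfl⟩) : _ ∈ C) _
  have hS (s : MvLaurent n R) : algebraMap (MvLaurent n R) P.ResidueField s ∈ C := by
    induction s using AddMonoidAlgebra.induction_linear with
    | zero => rw [map_zero]; exact zero_mem _
    | add a b ha hb => rw [map_add]; exact add_mem ha hb
    | single u r =>
      have : AddMonoidAlgebra.single u r = algebraMap R (MvLaurent n R) r
          * (AddMonoidAlgebra.single u 1 : MvLaurent n R) := by
        rw [← Algebra.smul_def]; simp
      rw [this, map_mul, ← IsScalarTower.algebraMap_apply]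
      exact mul_mem (Subfield.subset_closure (Or.inl ⟨r, rfl⟩)) (hmon u)
  rw [eq_top_iff]
  rintro z -
  obtain ⟨a, b, -, rfl⟩ := IsFractionRing.div_surjective (MvLaurent n R ⧸ P) z
  obtain ⟨a, rfl⟩ := Ideal.Quotient.mk_surjective a
  obtain ⟨b, rfl⟩ := Ideal.Quotient.mk_surjective b
  exact div_mem (hS a) (hS b)

/-- If `P` is a prime stable under `φ`, in the support of a finite module with a `φ`-semilinear
automorphism, then the monomials are integral over `R` in the residue field of `P`. -/
theorem isIntegral_residueField [IsNoetherianRing R]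
    {A : Matrix (Fin n) (Fin n) ℤ} (hdet : A.det ≠ 0)
    (hA : ⨅ k : ℕ, LinearMap.range (A ^ (k + 1)).mulVecLin = ⊥)
    (φ : MvLaurent n R →+* MvLaurent n R)
    (hR : ∀ r : R, IsUnit r → ∃ r' : R, IsUnit r' ∧
      φ (algebraMap R (MvLaurent n R) r') = algebraMap R (MvLaurent n R) r)
    (h : ∀ u : Fin n → ℤ, ∃ r : R, IsUnit r ∧ φ (AddMonoidAlgebra.single u 1)
      = algebraMap R (MvLaurent n R) r * AddMonoidAlgebra.single (A *ᵥ u) 1)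
    {M : Type*} [AddCommGroup M] [Module (MvLaurent n R) M] [Module.Finite (MvLaurent n R) M]
    (θ : M ≃+ M) (hθ : ∀ (s : MvLaurent n R) (x : M), θ (s • x) = φ s • θ x)
    (P : Ideal (MvLaurent n R)) [P.IsPrime] (hPM : Module.annihilator (MvLaurent n R) M ≤ P)
    (hP : P = P.comap φ) (u : Fin n → ℤ) :
    IsIntegral R (algebraMap (MvLaurent n R) P.ResidueField (AddMonoidAlgebra.single u 1)) := by
  have hsurj := Ideal.ResidueField.map_surjective_of_semilinear φ (θ : M →+ M)
    θ.surjective hθ P hPM hP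
  let ψ : P.ResidueField ≃+* P.ResidueField := RingEquiv.ofBijective _
    ⟨(Ideal.ResidueField.map P P φ hP).injective, hsurj⟩
  have hψ (s : MvLaurent n R) : ψ (algebraMap _ _ s) = algebraMap _ _ (φ s) :=
    Ideal.ResidueField.map_algebraMap P P _ hP s
  have hRP (r : R) : algebraMap R P.ResidueField r
      = algebraMap (MvLaurent n R) P.ResidueField (algebraMap R (MvLaurent n R) r) :=
    IsScalarTower.algebraMap_apply R (MvLaurent n R) P.ResidueField r
  let t : Multiplicative (Fin n → ℤ) →* P.ResidueField :=
    (algebraMap (MvLaurent n R) P.ResidueField : _ →* _).comp (AddMonoidAlgebra.of R _)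
  have ht (u : Fin n → ℤ) : t (.ofAdd u)
      = algebraMap (MvLaurent n R) P.ResidueField (AddMonoidAlgebra.single u 1) := rfl
  rw [← ht]
  refine isIntegral_of_ringEquiv hdet hA t ?_ ψ (fun r hr => ?_) (fun u => ?_) u
  · simp only [ht]
    exact closure_residueField_eq_top P
  · obtain ⟨r', hr', e⟩ := hR r hr
    exact ⟨r', hr', by rw [hRP, hψ, e, hRP]⟩
  · obtain ⟨r, hr, e⟩ := h u
    exact ⟨r, hr, by rw [ht, ht, hψ, e, map_mul, hRP]⟩

end MvLaurent

/-! ### The main theorem -/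

theorem mainTheorem3 {R : Type*} [CommRing R] [IsNoetherianRing R] (n : ℕ)
    (A : Matrix (Fin n) (Fin n) ℤ) (hdet : A.det ≠ 0)
    (hA : ⨅ k : ℕ, LinearMap.range (A ^ (k + 1)).mulVecLin = ⊥)
    (φ : MvLaurent n R →+* MvLaurent n R) (hφ : Function.Injective φ)
    (hφR : Subring.map φ (algebraMap R (MvLaurent n R)).range
      = (algebraMap R (MvLaurent n R)).range)
    (g : Fin n → Rˣ)
    (hφT : ∀ j : Fin n, φ (MvLaurent.T R j)
      = algebraMap R (MvLaurent n R) (g j)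
        * ((∏ i : Fin n, MvLaurent.T R i ^ A i j : (MvLaurent n R)ˣ) : MvLaurent n R))
    {M : Type*} [AddCommGroup M] [Module (MvLaurent n R) M] [Module R M]
    [IsScalarTower R (MvLaurent n R) M] [Module.Finite (MvLaurent n R) M]
    (η : M ≃+ M) (hη : ∀ (s : MvLaurent n R) (x : M), η (s • x) = φ s • η x) :
    Module.Finite R M := by
  have hR1 (r : R) : ∃ r', φ (algebraMap R (MvLaurent n R) r) = algebraMap R _ r' := by
    have : φ (algebraMap R (MvLaurent n R) r) ∈ (algebraMap R (MvLaurent n R)).range :=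
      hφR ▸ Subring.mem_map.2 ⟨_, ⟨r, rfl⟩, rfl⟩
    obtain ⟨r', e⟩ := this
    exact ⟨r', e.symm⟩
  have hR2 (r : R) : ∃ r', φ (algebraMap R (MvLaurent n R) r') = algebraMap R _ r := by
    have : algebraMap R (MvLaurent n R) r ∈ Subring.map φ (algebraMap R (MvLaurent n R)).range :=
      hφR.symm ▸ ⟨r, rfl⟩
    obtain ⟨_, ⟨r', rfl⟩, e⟩ := Subring.mem_map.1 this
    exact ⟨r', e⟩
  have hU1 (r : R) (hr : IsUnit r) : ∃ r' : R, IsUnit r' ∧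
      φ (algebraMap R (MvLaurent n R) r) = algebraMap R (MvLaurent n R) r' := by
    obtain ⟨s, hs⟩ := hr.exists_right_inv
    obtain ⟨a, ha⟩ := hR1 r
    obtain ⟨b, hb⟩ := hR1 s
    refine ⟨a, .of_mul_eq_one b (MvLaurent.algebraMap_injective (n := n) ?_), ha⟩
    rw [map_mul, ← ha, ← hb, ← map_mul, ← map_mul, hs, map_one, map_one]
  have hU2 (r : R) (hr : IsUnit r) : ∃ r' : R, IsUnit r' ∧
      φ (algebraMap R (MvLaurent n R) r') = algebraMap R (MvLaurent n R) r := by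
    obtain ⟨s, hs⟩ := hr.exists_right_inv
    obtain ⟨a, ha⟩ := hR2 r
    obtain ⟨b, hb⟩ := hR2 s
    -- Injectivity of `φ` makes preimages of mutually inverse units mutually inverse.
    refine ⟨a, .of_mul_eq_one b (MvLaurent.algebraMap_injective (n := n) (hφ ?_)), ha⟩
    rw [map_mul, map_mul, ha, hb, ← map_mul, hs, map_one, map_one]
  have hI : (Module.annihilator (MvLaurent n R) M).comap φ = Module.annihilator _ M := by
    ext s
    rw [Ideal.mem_comap, Module.mem_annihilator, Module.mem_annihilator]
    refine ⟨fun h x => η.injective ?_, fun h x => ?_⟩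
    · rw [hη, h, map_zero]
    · obtain ⟨y, rfl⟩ := η.surjective x
      rw [← hη, h, map_zero]
  have : IsNoetherianRing (MvLaurent n R) := Algebra.FiniteType.isNoetherianRing R _
  apply MvLaurent.finite_of_isIntegral (n := n)
  intro u
  apply Ideal.Quotient.isIntegral_mk_of_minimalPrimes
  intro P _ hP
  obtain ⟨m, hm, hPm⟩ := Ideal.exists_comap_pow_eq_of_mem_minimalPrimes φ hI hP
  obtain ⟨θ, hθ⟩ := AddEquiv.exists_semilinear_pow φ η hη m
  -- The triple `φ`, `η`, `A` is replaced by `φ ^ m`, `θ`, `A ^ m`, for which `P` is stable.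
  exact MvLaurent.isIntegral_residueField (by rw [Matrix.det_pow]; exact pow_ne_zero m hdet)
    (Matrix.iInf_range_pow_mulVecLin_eq_bot hA hm) (φ ^ m)
    (MvLaurent.exists_pow_map_algebraMap_eq φ hU2 m)
    (MvLaurent.exists_pow_map_single A φ hU1 (MvLaurent.exists_map_single A φ g hφT) m)
    θ hθ P hP.1.2 hPm u
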